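/- Let $A,B\in\mathbb{C}^{2\times 2}$ be regular boundary conditions, i.e. the $2\times 4$ matrix $(A\;B)$ has rank $2$ and $A+ikB$ is invertible for some $k\in\mathbb{C}$. Let $\Delta(A,B)$ be the operator in $L^2([0,\infty);\mathbb{C})\oplus L^2([0,\infty);\mathbb{C})$ given by $\Delta(A,B)\psi=\psi''$, whose domain consists of all $\psi=(\psi_1,\psi_2)\in H^2([0,\infty))\oplus H^2([0,\infty))$ with $$A\begin{bmatrix}\psi_1(0)\\ \psi_2(0)\end{bmatrix}+B\begin{bmatrix}\psi_1'(0)\\ \psi_2'(0)\end{bmatrix}=0,$$ and let $\mathfrak{S}(k;A,B):=-(A+ikB)^{-1}(A-ikB)$ for all $k\in\mathbb{C}$ for which $A+ikB$ is invertible. Suppose that $\Delta(A,B)$ generates a quasi-contractive $C_0$-semigroup $(T(t))_{t\ge 0}$, i.e. $\|T(t)\|\le e^{\omega t}$ for all $t\ge 0$ and some $\omega\in\mathbb{R}$. Then: 1. The semigroup is real (it maps a.e. real-valued functions to a.e. real-valued functions) if and only if $\mathfrak{S}(i\kappa;A,B)$ has real entries for every $\kappa>0$ for which it is defined (i.e.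 $A-\kappa B$ is invertible); this is also equivalent to $\mathfrak{S}(i\kappa;A,B)$ being defined and having real entries for at least one $\kappa>0$. 2. If there is $\kappa_0\in\mathbb{R}$ such that for all $\kappa\ge\kappa_0$ the matrix $\mathfrak{S}(i\kappa;A,B)$ is defined and $I+\mathfrak{S}(i\kappa;A,B)$ leaves $\{\xi\in\mathbb{R}^2:\xi_1\ge 0,\ \xi_2\ge 0\}$ invariant (where $I$ is the $2\times 2$ identity matrix), then the semigroup is positive (it maps functions that are real-valued and nonnegative a.e. to functions that are real-valued and nonnegative a.e.); in particular it is then also real. -/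

import Mathlib

open MeasureTheory Filter Topology
open scoped NNReal

noncomputable section

namespace PointInteraction

/-! ### Strongly continuous semigroups -/

/-- A `C₀`-semigroup of bounded linear operators on a complex normed space `X`. -/
structure C0Semigroup (X : Type*) [NormedAddCommGroup X] [NormedSpace ℂ X] where
  /-- the operator at time `t` -/
  op : ℝ≥0 → X →L[ℂ] X
  op_zero : op 0 = ContinuousLinearMap.id ℂ X
  op_add : ∀ s t : ℝ≥0, op (s + t) = (op s).comp (op t)
  strongly_continuous : ∀ x : X, Continuous fun t : ℝ≥0 => op t x

namespace C0Semigroup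

variable {X : Type*} [NormedAddCommGroup X] [NormedSpace ℂ X]

/-- The graph of the infinitesimal generator of `T`: the pairs `(x, y)` such that
`(T(t) x - x) / t → y` in norm as `t ↓ 0`. -/
def generatorGraph (T : C0Semigroup X) : Set (X × X) :=
  {p | Tendsto (fun t : ℝ≥0 => ((t : ℝ) : ℂ)⁻¹ • (T.op t p.1 - p.1)) (𝓝[>] 0) (𝓝 p.2)}

/-- `T` is quasi-contractive: `‖T(t)‖ ≤ e^{ω t}` for all `t ≥ 0`, for some real `ω`. -/
def IsQuasiContractive (T : C0Semigroup X) : Prop :=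
  ∃ ω : ℝ, ∀ t : ℝ≥0, ‖T.op t‖ ≤ Real.exp (ω * (t : ℝ))

end C0Semigroup

/-! ### The Hilbert space `L²([0,∞)) ⊕ L²([0,∞))` and the Laplacian `Δ(A,B)` -/

/-- Lebesgue measure on the half-line `[0,∞)`. -/
abbrev halfLine : Measure ℝ := volume.restrict (Set.Ici 0)

/-- Complex-valued `L²([0,∞))`. -/
abbrev L2Half : Type := Lp ℂ 2 halfLine

/-- The Hilbert space `L²([0,∞)) ⊕ L²([0,∞))`, with norm `(‖f₁‖² + ‖f₂‖²)^{1/2}`. -/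
abbrev L2Star : Type := PiLp 2 fun _ : Fin 2 => L2Half

/-- `v ∈ L²([0,∞))` is the weak derivative of `u ∈ L²([0,∞))`:
`∫ φ' u = - ∫ φ v` for all smooth `φ` with compact support in `(0,∞)`. -/
def HasWeakDeriv (u v : L2Half) : Prop :=
  ∀ φ : ℝ → ℝ, ContDiff ℝ (⊤ : ℕ∞) φ → HasCompactSupport φ → tsupport φ ⊆ Set.Ioi 0 →
    ∫ x, ((deriv φ x : ℝ) : ℂ) * u x ∂halfLine = - ∫ x, (φ x : ℂ) * v x ∂halfLine

/-- `c` is the value at `0` of the representative of `u` that is continuous on `[0,∞)`. -/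
def HasBoundaryValue (u : L2Half) (c : ℂ) : Prop :=
  ∃ g : ℝ → ℂ, ContinuousOn g (Set.Ici 0) ∧ u =ᵐ[halfLine] g ∧ g 0 = c

/-- The graph of `Δ(A,B)`: the pairs `(ψ, ψ'')` with `ψ ∈ H²([0,∞)) ⊕ H²([0,∞))`
(that is, `ψ` has weak derivatives `ψ'` and `ψ''` in `L²`) whose boundary values
`a = (ψ₁(0), ψ₂(0))` and `b = (ψ₁'(0), ψ₂'(0))` satisfy `A a + B b = 0`. -/
def laplacianGraph (A B : Matrix (Fin 2) (Fin 2) ℂ) : Set (L2Star × L2Star) :=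
  {p | ∃ dψ : L2Star,
    (∀ j, HasWeakDeriv (p.1 j) (dψ j)) ∧ (∀ j, HasWeakDeriv (dψ j) (p.2 j)) ∧
    ∃ a b : Fin 2 → ℂ, (∀ j, HasBoundaryValue (p.1 j) (a j)) ∧
      (∀ j, HasBoundaryValue (dψ j) (b j)) ∧ A.mulVec a + B.mulVec b = 0}

/-- `Δ(A,B)` is the infinitesimal generator of the `C₀`-semigroup `T`
(equality of operators, with their domains). -/
def IsGeneratedByLaplacian (T : C0Semigroup L2Star) (A B : Matrix (Fin 2) (Fin 2) ℂ) : Prop :=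
  T.generatorGraph = laplacianGraph A B

/-! ### Boundary conditions and Cayley transform -/

/-- Regular boundary conditions: the `2 × 4` matrix `(A B)` has rank two and `A + ikB` is
invertible for some complex `k`. -/
def IsRegular (A B : Matrix (Fin 2) (Fin 2) ℂ) : Prop :=
  (Matrix.fromCols A B).rank = 2 ∧ ∃ k : ℂ, IsUnit (A + (Complex.I * k) • B)

/-- The Cayley transform `𝔖(k;A,B) = -(A + ikB)⁻¹ (A - ikB)`, meaningful where `A + ikB` is
invertible. -/
def cayley (k : ℂ) (A B : Matrix (Fin 2) (Fin 2) ℂ) : Matrix (Fin 2) (Fin 2) ℂ :=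
  -((A + (Complex.I * k) • B)⁻¹ * (A - (Complex.I * k) • B))

/-- `𝔖(k;A,B)` exists, i.e. `A + ikB` is invertible. -/
def CayleyDefined (k : ℂ) (A B : Matrix (Fin 2) (Fin 2) ℂ) : Prop :=
  IsUnit (A + (Complex.I * k) • B)

/-- All entries of a complex matrix are real. -/
def HasRealEntries (M : Matrix (Fin 2) (Fin 2) ℂ) : Prop := ∀ i j, (M i j).im = 0

/-- A complex matrix maps the quadrant `{ξ ∈ ℝ² : ξ₁ ≥ 0, ξ₂ ≥ 0}` into itself. -/
def LeavesQuadrantInvariant (M : Matrix (Fin 2) (Fin 2) ℂ) : Prop :=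
  ∀ ξ : Fin 2 → ℝ, (∀ j, 0 ≤ ξ j) →
    ∃ η : Fin 2 → ℝ, (∀ j, 0 ≤ η j) ∧ M.mulVec (fun j => (ξ j : ℂ)) = fun j => (η j : ℂ)

/-! ### Real and positive semigroups -/

/-- `f` is real-valued almost everywhere. -/
def IsRealFun (f : L2Star) : Prop := ∀ j, ∀ᵐ x ∂halfLine, (f j x).im = 0

/-- `f` is real-valued and nonnegative almost everywhere. -/
def IsPosFun (f : L2Star) : Prop := ∀ j, ∀ᵐ x ∂halfLine, (f j x).im = 0 ∧ 0 ≤ (f j x).re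

/-- The semigroup is real: it maps real-valued functions to real-valued functions. -/
def IsRealSemigroup (T : C0Semigroup L2Star) : Prop :=
  ∀ (t : ℝ≥0) (f : L2Star), IsRealFun f → IsRealFun (T.op t f)

/-- The semigroup is positive: it maps nonnegative functions to nonnegative functions. -/
def IsPositiveSemigroup (T : C0Semigroup L2Star) : Prop :=
  ∀ (t : ℝ≥0) (f : L2Star), IsPosFun f → IsPosFun (T.op t f)

end PointInteraction

end

noncomputable section

namespace PointInteraction

/-! ### Resolvents of quasi-contractive semigroups and the exponential formula -/

/-! Both parts reduce to the resolvents R_h = (1 - hΔ)⁻¹ of the generator Δ = Δ(A,B). Since T(t)x =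
lim (R_{t/n})ⁿ x on the domain, a closed set invariant under R_h for all small h > 0 is invariant
under the semigroup (`op_mem_of_scaledResolvent_mem`). The real functions and the nonnegative
functions are such closed sets.

For positivity put h = κ⁻². Then u = R_h f solves u'' = κ²(u - f), which splits into first-order
equations: v = u' + κu satisfies v' - κv = -κ²f. If f ≥ 0, then e^{-κx}v is nonincreasing, and
square integrability forces v ≥ 0. The boundary condition says u(0) = (2κ)⁻¹(I + 𝔖(iκ))v(0)
(`boundary_condition_iff`), so invariance of the quadrant gives u(0) ≥ 0. Finally e^{κx}u is
nondecreasing, hence u ≥ 0.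

For reality, T is real iff the graph of Δ is invariant under conjugation, hence iff the space of
boundary data Aa + Bb = 0 is. The same formula parametrises this space by κa + b through I + 𝔖(iκ),
so its invariance means that 𝔖(iκ) is real (`hasRealEntries_cayley_iff`). The space does not involve
κ, so one κ is as good as all of them, and regularity supplies one (`exists_cayleyDefined`). -/

theorem norm_iterate_le {X : Type*} [NormedAddCommGroup X] {P : X → X} {M : ℝ} (hM : 0 ≤ M)
    (hP : ∀ x, ‖P x‖ ≤ M * ‖x‖) (n : ℕ) (x : X) : ‖P^[n] x‖ ≤ M ^ n * ‖x‖ := by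
  induction n generalizing x with
  | zero => simp
  | succ n ih =>
    rw [Function.iterate_succ_apply, pow_succ, mul_assoc]
    exact (ih _).trans (mul_le_mul_of_nonneg_left (hP x) (pow_nonneg hM n))

theorem iterate_map_sub' {X : Type*} [AddCommGroup X] {P : X → X}
    (hP : ∀ x y, P (x - y) = P x - P y) (n : ℕ) (x y : X) :
    P^[n] (x - y) = P^[n] x - P^[n] y := by
  induction n generalizing x y with
  | zero => simp
  | succ n ih => simp only [Function.iterate_succ_apply, hP, ih]

/-- Telescoping: commutation lets each difference P - Q act directly on x. The maps are unbundled
because the scaled resolvent is a bare integral. -/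
theorem norm_iterate_sub_iterate_le {X : Type*} [NormedAddCommGroup X] {P Q : X → X} {M : ℝ}
    (hM : 1 ≤ M) (hPs : ∀ x y, P (x - y) = P x - P y) (hQs : ∀ x y, Q (x - y) = Q x - Q y)
    (hP : ∀ x, ‖P x‖ ≤ M * ‖x‖) (hQ : ∀ x, ‖Q x‖ ≤ M * ‖x‖) (hPQ : ∀ x, P (Q x) = Q (P x))
    (n : ℕ) (x : X) : ‖P^[n] x - Q^[n] x‖ ≤ n * M ^ n * ‖P x - Q x‖ := by
  have hM0 : 0 ≤ M := zero_le_one.trans hM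
  induction n generalizing x with
  | zero => simp
  | succ n ih =>
    have h1 : P^[n + 1] x - Q^[n + 1] x
        = P^[n] (P x - Q x) + (P^[n] (Q x) - Q^[n] (Q x)) := by
      rw [Function.iterate_succ_apply, Function.iterate_succ_apply, iterate_map_sub' hPs]
      abel
    have h2 : ‖P (Q x) - Q (Q x)‖ ≤ M * ‖P x - Q x‖ := by
      rw [hPQ, ← hQs]
      exact hQ _
    have h3 := norm_iterate_le hM0 hP n (P x - Q x)
    have h4 := (ih (Q x)).trans (mul_le_mul_of_nonneg_left h2 (by positivity))
    have h5 : M ^ n * ‖P x - Q x‖ ≤ M ^ (n + 1) * ‖P x - Q x‖ :=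
      mul_le_mul_of_nonneg_right (pow_le_pow_right₀ hM n.le_succ) (norm_nonneg _)
    rw [h1]
    refine (norm_add_le _ _).trans ((add_le_add (h3.trans h5) h4).trans (le_of_eq ?_))
    push_cast
    ring

namespace C0Semigroup

variable {X : Type*} [NormedAddCommGroup X] [NormedSpace ℂ X] (T : C0Semigroup X)

theorem op_comm (s t : ℝ≥0) (x : X) : T.op s (T.op t x) = T.op t (T.op s x) := by
  rw [← ContinuousLinearMap.comp_apply, ← T.op_add, add_comm, T.op_add,
    ContinuousLinearMap.comp_apply]

theorem op_iterate (h : ℝ≥0) (n : ℕ) (x : X) : (T.op h)^[n] x = T.op (n * h) x := by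
  induction n generalizing x with
  | zero => simp [T.op_zero]
  | succ n ih =>
    rw [Function.iterate_succ_apply, ih, ← ContinuousLinearMap.comp_apply, ← T.op_add]
    push_cast
    rw [add_mul, one_mul]

/-- The integrand of the scaled Laplace transform of the orbit of `y`. -/
def laplaceIntegrand (h : ℝ≥0) (y : X) (s : ℝ) : X :=
  Real.exp (-s) • T.op (h * s.toNNReal) y

/-- The scaled resolvent `(1 - h A)⁻¹ y = ∫₀^∞ e^{-s} T(h s) y ds`, where `A` is the generator. -/
def scaledResolvent (h : ℝ≥0) (y : X) : X :=
  ∫ s in Set.Ioi (0 : ℝ), T.laplaceIntegrand h y s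

theorem continuous_laplaceIntegrand (h : ℝ≥0) (y : X) :
    Continuous (T.laplaceIntegrand h y) := by
  unfold laplaceIntegrand
  have h1 : Continuous fun s : ℝ => T.op (h * s.toNNReal) y :=
    (T.strongly_continuous y).comp (continuous_const.mul continuous_real_toNNReal)
  fun_prop

variable {T} {ω : ℝ} {h : ℝ≥0}

theorem norm_laplaceIntegrand_le (hT : ∀ t : ℝ≥0, ‖T.op t‖ ≤ Real.exp (ω * t))
    (y : X) {s : ℝ} (hs : 0 ≤ s) :
    ‖T.laplaceIntegrand h y s‖ ≤ Real.exp (-(1 - ω * h) * s) * ‖y‖ := by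
  unfold laplaceIntegrand
  have h1 := (T.op (h * s.toNNReal)).le_of_opNorm_le (hT _) y
  rw [norm_smul, Real.norm_of_nonneg (Real.exp_pos _).le]
  refine (mul_le_mul_of_nonneg_left h1 (Real.exp_pos _).le).trans (le_of_eq ?_)
  rw [← mul_assoc, ← Real.exp_add, NNReal.coe_mul, Real.coe_toNNReal s hs]
  ring_nf

theorem integrableOn_laplaceIntegrand (hT : ∀ t : ℝ≥0, ‖T.op t‖ ≤ Real.exp (ω * t))
    (hh : ω * h ≤ 1 / 2) (y : X) :
    IntegrableOn (T.laplaceIntegrand h y) (Set.Ioi 0) := by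
  have h1 : IntegrableOn (fun s : ℝ => Real.exp (-(1 - ω * h) * s) * ‖y‖) (Set.Ioi 0) :=
    (exp_neg_integrableOn_Ioi 0 (by linarith)).mul_const _
  refine h1.mono' (T.continuous_laplaceIntegrand h y).aestronglyMeasurable ?_
  refine (ae_restrict_iff' measurableSet_Ioi).2 (Eventually.of_forall fun s hs => ?_)
  exact norm_laplaceIntegrand_le hT y (le_of_lt hs)

theorem scaledResolvent_sub (hT : ∀ t : ℝ≥0, ‖T.op t‖ ≤ Real.exp (ω * t))
    (hh : ω * h ≤ 1 / 2) (x y : X) :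
    T.scaledResolvent h (x - y) = T.scaledResolvent h x - T.scaledResolvent h y := by
  unfold scaledResolvent
  rw [← integral_sub (integrableOn_laplaceIntegrand hT hh x)
    (integrableOn_laplaceIntegrand hT hh y)]
  refine integral_congr_ae (Eventually.of_forall fun s => ?_)
  simp [laplaceIntegrand, smul_sub]

theorem scaledResolvent_smul (c : ℂ) (x : X) :
    T.scaledResolvent h (c • x) = c • T.scaledResolvent h x := by
  unfold scaledResolvent
  rw [← integral_smul]
  refine integral_congr_ae (Eventually.of_forall fun s => ?_)
  simp [laplaceIntegrand, smul_comm c]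

theorem norm_scaledResolvent_le (hT : ∀ t : ℝ≥0, ‖T.op t‖ ≤ Real.exp (ω * t)) (hω : 0 ≤ ω)
    (hh : ω * h ≤ 1 / 2) (y : X) :
    ‖T.scaledResolvent h y‖ ≤ Real.exp (2 * ω * h) * ‖y‖ := by
  have hx : 0 ≤ ω * h := mul_nonneg hω h.2
  have h1 : IntegrableOn (fun s : ℝ => Real.exp (-(1 - ω * h) * s) * ‖y‖) (Set.Ioi 0) :=
    (exp_neg_integrableOn_Ioi 0 (by linarith)).mul_const _
  have h2 : ‖T.scaledResolvent h y‖
      ≤ ∫ s in Set.Ioi (0 : ℝ), Real.exp (-(1 - ω * h) * s) * ‖y‖ := by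
    refine norm_integral_le_of_norm_le h1 ?_
    refine (ae_restrict_iff' measurableSet_Ioi).2 (Eventually.of_forall fun s hs => ?_)
    exact norm_laplaceIntegrand_le hT y (le_of_lt hs)
  refine h2.trans ?_
  rw [integral_mul_const, integral_exp_mul_Ioi (by linarith)]
  refine mul_le_mul_of_nonneg_right ?_ (norm_nonneg _)
  rw [mul_zero, Real.exp_zero, neg_div_neg_eq, div_le_iff₀ (by linarith)]
  -- With x = ωh ∈ [0, 1/2]: 1/(1 - x) ≤ 1 + 2x ≤ e^{2x}. The exponential form keeps n-th powers
  -- bounded when nh = t.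
  have h3 := Real.add_one_le_exp (2 * ω * h)
  nlinarith

variable [CompleteSpace X]

theorem op_scaledResolvent (hT : ∀ t : ℝ≥0, ‖T.op t‖ ≤ Real.exp (ω * t))
    (hh : ω * h ≤ 1 / 2) (t : ℝ≥0) (y : X) :
    T.op t (T.scaledResolvent h y) = ∫ s in Set.Ioi (0 : ℝ), T.op t (T.laplaceIntegrand h y s) :=
  ((T.op t).integral_comp_comm (integrableOn_laplaceIntegrand hT hh y)).symm

theorem scaledResolvent_op (hT : ∀ t : ℝ≥0, ‖T.op t‖ ≤ Real.exp (ω * t))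
    (hh : ω * h ≤ 1 / 2) (t : ℝ≥0) (y : X) :
    T.scaledResolvent h (T.op t y) = T.op t (T.scaledResolvent h y) := by
  rw [op_scaledResolvent hT hh]
  refine integral_congr_ae (Eventually.of_forall fun s => ?_)
  simp [laplaceIntegrand, T.op_comm t, (T.op t).map_smul_of_tower]

/-- The shift s ↦ s + t/h moves T(t) into the lower limit of the integral, so the orbit becomes
differentiable in t for every y. -/
theorem op_scaledResolvent_eq (hT : ∀ t : ℝ≥0, ‖T.op t‖ ≤ Real.exp (ω * t))
    (hh : ω * h ≤ 1 / 2) (h0 : 0 < h) (t : ℝ≥0) (y : X) :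
    T.op t (T.scaledResolvent h y) = Real.exp (t / h) •
      (T.scaledResolvent h y - ∫ s in (0 : ℝ)..(t / h), T.laplaceIntegrand h y s) := by
  have hth : (0 : ℝ) ≤ t / h := by positivity
  have hint := integrableOn_laplaceIntegrand hT hh y
  have h1 : T.scaledResolvent h y - ∫ s in (0 : ℝ)..(t / h), T.laplaceIntegrand h y s
      = ∫ s in Set.Ioi (t / h : ℝ), T.laplaceIntegrand h y s := by
    rw [sub_eq_iff_eq_add', scaledResolvent]
    exact (intervalIntegral.integral_interval_add_Ioi hint
      (hint.mono_set (Set.Ioi_subset_Ioi hth))).symm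
  rw [h1, op_scaledResolvent hT hh, ← integral_smul]
  have h2 := (measurePreserving_add_right volume (t / h : ℝ)).setIntegral_preimage_emb
    (measurableEmbedding_addRight _)
    (fun s => Real.exp (t / h) • T.laplaceIntegrand h y s) (Set.Ioi (t / h : ℝ))
  rw [Set.preimage_add_const_Ioi, sub_self] at h2
  rw [← h2]
  refine setIntegral_congr_fun measurableSet_Ioi fun s hs => ?_
  have hs0 : (0 : ℝ) ≤ s := le_of_lt hs
  have h3 : h * (s + t / h : ℝ).toNNReal = t + h * s.toNNReal := by
    apply NNReal.eq
    have : (h : ℝ) ≠ 0 := by exact_mod_cast h0.ne'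
    push_cast
    rw [Real.coe_toNNReal _ hs0, Real.coe_toNNReal _ (by positivity)]
    field_simp
    ring
  simp only [laplaceIntegrand]
  rw [h3, T.op_add, ContinuousLinearMap.comp_apply, (T.op t).map_smul_of_tower, smul_smul,
    ← Real.exp_add]
  congr 2
  ring

theorem scaledResolvent_mem_generatorGraph (hT : ∀ t : ℝ≥0, ‖T.op t‖ ≤ Real.exp (ω * t))
    (hh : ω * h ≤ 1 / 2) (h0 : 0 < h) (y : X) :
    (T.scaledResolvent h y, ((h : ℝ) : ℂ)⁻¹ • (T.scaledResolvent h y - y))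
      ∈ T.generatorGraph := by
  -- The formula also makes sense for t < 0, so an ordinary two-sided derivative at 0 can be used
  -- and then restricted to t ↓ 0.
  set Φ : ℝ → X := fun t => Real.exp (t / h) •
      (T.scaledResolvent h y - ∫ s in (0 : ℝ)..(t / h), T.laplaceIntegrand h y s) with hΦ
  have hd : HasDerivAt Φ ((h : ℝ)⁻¹ • (T.scaledResolvent h y - y)) 0 := by
    have h1 : HasDerivAt (fun t : ℝ => t / (h : ℝ)) (h : ℝ)⁻¹ 0 := by
      simpa [one_div] using (hasDerivAt_id (0 : ℝ)).div_const (h : ℝ)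
    have h2 : HasDerivAt (fun u : ℝ => ∫ s in (0 : ℝ)..u, T.laplaceIntegrand h y s)
        (T.laplaceIntegrand h y 0) ((fun t : ℝ => t / (h : ℝ)) 0) := by
      simpa using ((T.continuous_laplaceIntegrand h y).integral_hasStrictDerivAt 0 0).hasDerivAt
    have h3 := h2.scomp (0 : ℝ) h1
    have h4 := (h1.exp).smul (h3.const_sub (T.scaledResolvent h y))
    refine HasDerivAt.congr_deriv (f' := _) h4 ?_
    simp only [laplaceIntegrand, T.op_zero, zero_div, Real.exp_zero, one_smul, one_mul,
      Function.comp, intervalIntegral.integral_same, sub_zero, neg_zero, Real.toNNReal_zero,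
      mul_zero, smul_sub, ContinuousLinearMap.id_apply]
    abel
  have hΦ0 : Φ 0 = T.scaledResolvent h y := by simp [hΦ]
  have h5 := hasDerivAt_iff_tendsto_slope_zero.1 hd
  have hc : Tendsto (fun t : ℝ≥0 => (t : ℝ)) (𝓝[>] 0) (𝓝[≠] 0) := by
    refine tendsto_nhdsWithin_of_tendsto_nhds_of_eventually_within _
      (NNReal.continuous_coe.tendsto' 0 0 rfl |>.mono_left nhdsWithin_le_nhds) ?_
    filter_upwards [self_mem_nhdsWithin] with t ht
    exact (NNReal.coe_pos.2 ht).ne'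
  have h6 := h5.comp hc
  have e1 : ((h : ℝ) : ℂ)⁻¹ • (T.scaledResolvent h y - y)
      = (h : ℝ)⁻¹ • (T.scaledResolvent h y - y) := by
    rw [← Complex.ofReal_inv, Complex.coe_smul]
  change Tendsto _ _ (𝓝 _)
  rw [e1]
  refine h6.congr fun t => ?_
  simp only [Function.comp, zero_add, hΦ0]
  rw [← Complex.ofReal_inv, Complex.coe_smul, op_scaledResolvent_eq hT hh h0]

/-- The resolvent is continuous and commutes with the semigroup, so it carries the difference
quotients of x to those of its image; their limit was computed in
`scaledResolvent_mem_generatorGraph`. -/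
theorem scaledResolvent_eq_of_mem_generatorGraph
    (hT : ∀ t : ℝ≥0, ‖T.op t‖ ≤ Real.exp (ω * t)) (hω : 0 ≤ ω)
    (hh : ω * h ≤ 1 / 2) (h0 : 0 < h) {x y : X} (hxy : (x, y) ∈ T.generatorGraph) :
    T.scaledResolvent h x - x = ((h : ℝ) : ℂ) • T.scaledResolvent h y := by
  have hcont : Continuous (T.scaledResolvent h) := by
    refine LipschitzWith.continuous (K := (Real.exp (2 * ω * h)).toNNReal)
      (LipschitzWith.of_dist_le_mul fun a b => ?_)
    rw [dist_eq_norm, dist_eq_norm, ← scaledResolvent_sub hT hh,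
      Real.coe_toNNReal _ (Real.exp_pos _).le]
    exact norm_scaledResolvent_le hT hω hh _
  have h1 : Tendsto (fun t : ℝ≥0 => ((t : ℝ) : ℂ)⁻¹ •
      (T.op t (T.scaledResolvent h x) - T.scaledResolvent h x)) (𝓝[>] 0)
      (𝓝 (T.scaledResolvent h y)) := by
    refine ((hcont.tendsto y).comp hxy).congr fun t => ?_
    simp only [Function.comp]
    rw [scaledResolvent_smul, scaledResolvent_sub hT hh, scaledResolvent_op hT hh]
  have h2 := tendsto_nhds_unique h1 (scaledResolvent_mem_generatorGraph hT hh h0 x)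
  have hne : ((h : ℝ) : ℂ) ≠ 0 := by exact_mod_cast h0.ne'
  rw [h2, smul_smul, mul_inv_cancel₀ hne, one_smul]

theorem scaledResolvent_sub_smul_of_mem_generatorGraph
    (hT : ∀ t : ℝ≥0, ‖T.op t‖ ≤ Real.exp (ω * t)) (hω : 0 ≤ ω)
    (hh : ω * h ≤ 1 / 2) (h0 : 0 < h) {x y : X} (hxy : (x, y) ∈ T.generatorGraph) :
    T.scaledResolvent h (x - ((h : ℝ) : ℂ) • y) = x := by
  rw [scaledResolvent_sub hT hh, scaledResolvent_smul,
    ← scaledResolvent_eq_of_mem_generatorGraph hT hω hh h0 hxy, sub_sub_cancel]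

theorem eventually_mul_le_half (ω : ℝ) : ∀ᶠ h : ℝ≥0 in 𝓝[>] 0, ω * h ≤ 1 / 2 := by
  have h1 : Tendsto (fun h : ℝ≥0 => ω * (h : ℝ)) (𝓝 0) (𝓝 0) :=
    (continuous_const.mul NNReal.continuous_coe).tendsto' _ _ (by simp)
  exact (h1.mono_left nhdsWithin_le_nhds).eventually_le_const (by norm_num)

theorem tendsto_scaledResolvent (hT : ∀ t : ℝ≥0, ‖T.op t‖ ≤ Real.exp (ω * t)) (y : X) :
    Tendsto (fun h => T.scaledResolvent h y) (𝓝[>] 0) (𝓝 y) := by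
  have hy : ∫ s in Set.Ioi (0 : ℝ), Real.exp (-s) • y = y := by
    rw [integral_smul_const, integral_exp_neg_Ioi_zero, one_smul]
  conv => enter [3, 1]; rw [← hy]
  unfold scaledResolvent
  refine tendsto_integral_filter_of_dominated_convergence
    (fun s => Real.exp (-(1 / 2) * s) * ‖y‖) ?_ ?_ ?_ ?_
  · exact Eventually.of_forall fun h =>
      (T.continuous_laplaceIntegrand h y).aestronglyMeasurable
  · filter_upwards [eventually_mul_le_half ω] with h hh
    refine (ae_restrict_iff' measurableSet_Ioi).2 (Eventually.of_forall fun s hs => ?_)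
    have hs0 : (0 : ℝ) ≤ s := le_of_lt hs
    refine (norm_laplaceIntegrand_le hT y hs0).trans ?_
    gcongr
    linarith
  · exact (exp_neg_integrableOn_Ioi 0 (by norm_num)).mul_const _
  · refine Eventually.of_forall fun s => ?_
    have h1 : Continuous fun h : ℝ≥0 => T.laplaceIntegrand h y s := by
      unfold laplaceIntegrand
      exact ((T.strongly_continuous y).comp (continuous_id.mul continuous_const)).const_smul _
    refine (h1.tendsto' 0 _ ?_).mono_left nhdsWithin_le_nhds
    simp [laplaceIntegrand, T.op_zero]

/-- One step of size h = t/(n+1) has error o(h) on the domain, since the resolvent and T(h) agree to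
first order there. Telescoping multiplies it by n+1 and a factor bounded by e^{2ωt}. -/
theorem tendsto_scaledResolvent_iterate (hT : ∀ t : ℝ≥0, ‖T.op t‖ ≤ Real.exp (ω * t))
    (hω : 0 ≤ ω) {x y : X} (hxy : (x, y) ∈ T.generatorGraph) {t : ℝ≥0} (ht : 0 < t) :
    Tendsto (fun n : ℕ => (T.scaledResolvent (t / (n + 1 : ℕ)))^[n + 1] x) atTop
      (𝓝 (T.op t x)) := by
  have hn0 : ∀ n : ℕ, 0 < t / (n + 1 : ℕ) := fun n => by positivity
  have hlim : Tendsto (fun n : ℕ => t / ((n + 1 : ℕ) : ℝ≥0)) atTop (𝓝[>] 0) := by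
    refine tendsto_nhdsWithin_of_tendsto_nhds_of_eventually_within _ ?_
      (Eventually.of_forall hn0)
    exact (tendsto_const_div_atTop_nhds_zero_nat t).comp (tendsto_add_atTop_nat 1)
  have h1 : Tendsto (fun h : ℝ≥0 => T.scaledResolvent h y - ((h : ℝ) : ℂ)⁻¹ • (T.op h x - x))
      (𝓝[>] 0) (𝓝 0) := by
    simpa using (tendsto_scaledResolvent hT y).sub hxy
  have h2 := ((h1.comp hlim).norm.const_mul (Real.exp (2 * ω * t) * t))
  rw [norm_zero, mul_zero] at h2
  rw [tendsto_iff_norm_sub_tendsto_zero]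
  refine squeeze_zero' (Eventually.of_forall fun n => norm_nonneg _) ?_ h2
  filter_upwards [hlim.eventually (eventually_mul_le_half ω)] with n hh
  set h : ℝ≥0 := t / (n + 1 : ℕ) with hdef
  have hpos : 0 < h := hn0 n
  have hnh : ((n + 1 : ℕ) : ℝ≥0) * h = t := mul_div_cancel₀ t (by positivity)
  have hnh' : ((n + 1 : ℕ) : ℝ) * (h : ℝ) = t := by exact_mod_cast hnh
  have hM : 1 ≤ Real.exp (2 * ω * h) := Real.one_le_exp (by positivity)
  have hQ : ∀ z, ‖T.op h z‖ ≤ Real.exp (2 * ω * h) * ‖z‖ := fun z => by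
    refine (T.op h).le_of_opNorm_le ((hT h).trans (Real.exp_le_exp.2 ?_)) z
    have : 0 ≤ ω * h := mul_nonneg hω h.2
    linarith
  have h3 := norm_iterate_sub_iterate_le hM (scaledResolvent_sub hT hh)
    (fun a b => map_sub (T.op h) a b) (norm_scaledResolvent_le hT hω hh) hQ
    (fun z => scaledResolvent_op hT hh h z) (n + 1) x
  rw [op_iterate, hnh] at h3
  refine h3.trans (le_of_eq ?_)
  have h4 : T.scaledResolvent h x - T.op h x
      = ((h : ℝ) : ℂ) • (T.scaledResolvent h y - ((h : ℝ) : ℂ)⁻¹ • (T.op h x - x)) := by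
    have hne : ((h : ℝ) : ℂ) ≠ 0 := by exact_mod_cast hpos.ne'
    rw [smul_sub, smul_smul, mul_inv_cancel₀ hne, one_smul,
      ← scaledResolvent_eq_of_mem_generatorGraph hT hω hh hpos hxy]
    abel
  rw [h4, norm_smul, ← Real.exp_nat_mul]
  simp only [Function.comp, ← hdef]
  have h5 : ((n + 1 : ℕ) : ℝ) * (2 * ω * h) = 2 * ω * t := by rw [← hnh']; ring
  rw [h5, Complex.norm_real, Real.norm_of_nonneg (NNReal.coe_nonneg h), ← hnh']
  ring

/-- A closed set that is invariant under the scaled resolvents is invariant under the semigroup. -/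
theorem op_mem_of_scaledResolvent_mem (hT : ∀ t : ℝ≥0, ‖T.op t‖ ≤ Real.exp (ω * t))
    (hω : 0 ≤ ω) {K : Set X} (hK : IsClosed K)
    (hinv : ∀ᶠ h in 𝓝[>] (0 : ℝ≥0), ∀ x ∈ K, T.scaledResolvent h x ∈ K)
    (t : ℝ≥0) {x : X} (hx : x ∈ K) : T.op t x ∈ K := by
  rcases eq_or_ne t 0 with rfl | ht
  · simpa [T.op_zero] using hx
  have ht : 0 < t := pos_iff_ne_zero.2 ht
  -- The exponential formula needs a point of the domain, so x is replaced by its image under the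
  -- resolvent, which still lies in K and tends to x.
  refine hK.mem_of_tendsto (((T.op t).continuous.tendsto x).comp (tendsto_scaledResolvent hT x)) ?_
  filter_upwards [hinv, eventually_mul_le_half ω, self_mem_nhdsWithin] with h hh1 hh2 hh3
  refine hK.mem_of_tendsto (tendsto_scaledResolvent_iterate hT hω
    (scaledResolvent_mem_generatorGraph hT hh2 hh3 x) ht) ?_
  have hlim : Tendsto (fun n : ℕ => t / ((n + 1 : ℕ) : ℝ≥0)) atTop (𝓝[>] 0) := by
    refine tendsto_nhdsWithin_of_tendsto_nhds_of_eventually_within _ ?_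
      (Eventually.of_forall fun n => Set.mem_Ioi.2 (by positivity))
    exact (tendsto_const_div_atTop_nhds_zero_nat t).comp (tendsto_add_atTop_nat 1)
  filter_upwards [hlim.eventually hinv] with n hn
  have : Set.MapsTo (T.scaledResolvent (t / (n + 1 : ℕ))) K K := fun z hz => hn z hz
  exact this.iterate (n + 1) (hh1 x hx)

end C0Semigroup

end PointInteraction

end

noncomputable section

namespace PointInteraction

/-! ### Monotonicity of functions with signed weak derivative -/

/-- A smooth step from `0` at `a` to `1` at `a + ε`. -/
def smoothStep (a ε : ℝ) (s : ℝ) : ℝ := Real.smoothTransition ((s - a) / ε)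

theorem contDiff_smoothStep (a ε : ℝ) : ContDiff ℝ (⊤ : ℕ∞) (smoothStep a ε) :=
  Real.smoothTransition.contDiff.comp ((contDiff_id.sub contDiff_const).div_const ε)

theorem continuous_deriv_smoothStep (a ε : ℝ) : Continuous (deriv (smoothStep a ε)) :=
  (contDiff_smoothStep a ε).continuous_deriv (by simp)

theorem differentiable_smoothStep (a ε : ℝ) : Differentiable ℝ (smoothStep a ε) :=
  (contDiff_smoothStep a ε).differentiable (by simp)

theorem smoothStep_of_le {a ε s : ℝ} (hε : 0 < ε) (hs : s ≤ a) : smoothStep a ε s = 0 :=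
  Real.smoothTransition.zero_of_nonpos (div_nonpos_of_nonpos_of_nonneg (by linarith) hε.le)

theorem smoothStep_of_ge {a ε s : ℝ} (hε : 0 < ε) (hs : a + ε ≤ s) : smoothStep a ε s = 1 :=
  Real.smoothTransition.one_of_one_le ((one_le_div hε).2 (by linarith))

theorem monotone_smoothStep {a ε : ℝ} (hε : 0 < ε) : Monotone (smoothStep a ε) := by
  intro s t hst
  refine Real.smoothTransition.monotone ?_
  gcongr

theorem deriv_smoothStep_nonneg {a ε : ℝ} (hε : 0 < ε) (s : ℝ) : 0 ≤ deriv (smoothStep a ε) s :=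
  (monotone_smoothStep hε).deriv_nonneg

theorem deriv_smoothStep_of_notMem {a ε s : ℝ} (hε : 0 < ε) (hs : s ∉ Set.Icc a (a + ε)) :
    deriv (smoothStep a ε) s = 0 := by
  rw [Set.mem_Icc, not_and_or, not_le, not_le] at hs
  rcases hs with hs | hs
  · have : smoothStep a ε =ᶠ[𝓝 s] fun _ => 0 := by
      filter_upwards [Iio_mem_nhds hs] with r hr using smoothStep_of_le hε (le_of_lt hr)
    rw [this.deriv_eq, deriv_const]
  · have : smoothStep a ε =ᶠ[𝓝 s] fun _ => 1 := by
      filter_upwards [Ioi_mem_nhds hs] with r hr using smoothStep_of_ge hε (le_of_lt hr)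
    rw [this.deriv_eq, deriv_const]

theorem setIntegral_deriv_smoothStep {a ε : ℝ} (hε : 0 < ε) :
    ∫ s in Set.Icc a (a + ε), deriv (smoothStep a ε) s = 1 := by
  rw [integral_Icc_eq_integral_Ioc, ← intervalIntegral.integral_of_le (by linarith),
    intervalIntegral.integral_deriv_eq_sub (fun s _ => differentiable_smoothStep a ε s)
      ((continuous_deriv_smoothStep a ε).intervalIntegrable _ _),
    smoothStep_of_ge hε le_rfl, smoothStep_of_le hε le_rfl, sub_zero]

theorem integrable_deriv_smoothStep_mul {a ε : ℝ} (ha : 0 ≤ a) (hε : 0 < ε) {G : ℝ → ℝ}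
    (hG : ContinuousOn G (Set.Ici 0)) :
    Integrable (fun s => deriv (smoothStep a ε) s * G s) halfLine := by
  have h1 : IntegrableOn (fun s => deriv (smoothStep a ε) s * G s) (Set.Icc a (a + ε)) :=
    ((continuous_deriv_smoothStep a ε).continuousOn.mul
      (hG.mono fun s hs => ha.trans hs.1)).integrableOn_Icc
  refine ((integrableOn_iff_integrable_of_support_subset fun s hs => ?_).1 h1).restrict
  by_contra hcon
  exact hs (by simp [deriv_smoothStep_of_notMem hε hcon])

/-- The derivative of the step is a probability density on [a, a + ε], so the integral is an average
of G there. -/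
theorem le_integral_deriv_smoothStep_mul {a ε c : ℝ} (ha : 0 ≤ a) (hε : 0 < ε) {G : ℝ → ℝ}
    (hG : ContinuousOn G (Set.Ici 0)) (hc : ∀ s ∈ Set.Icc a (a + ε), c ≤ G s) :
    c ≤ ∫ s, deriv (smoothStep a ε) s * G s ∂halfLine := by
  have hsub : Set.Icc a (a + ε) ⊆ Set.Ici 0 := fun s hs => ha.trans hs.1
  have h1 : ∫ s in Set.Icc a (a + ε), deriv (smoothStep a ε) s * G s
      = ∫ s, deriv (smoothStep a ε) s * G s ∂halfLine :=
    (setIntegral_eq_of_subset_of_forall_sdiff_eq_zero measurableSet_Ici hsub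
      (fun s hs => by simp [deriv_smoothStep_of_notMem hε hs.2])).symm
  rw [← h1]
  calc c = ∫ s in Set.Icc a (a + ε), deriv (smoothStep a ε) s * c := by
        rw [integral_mul_const, setIntegral_deriv_smoothStep hε, one_mul]
    _ ≤ _ := by
        refine setIntegral_mono_on ?_ ?_ measurableSet_Icc fun s hs =>
          mul_le_mul_of_nonneg_left (hc s hs) (deriv_smoothStep_nonneg hε s)
        · exact ((continuous_deriv_smoothStep a ε).mul continuous_const).continuousOn.integrableOn_Icc
        · exact ((continuous_deriv_smoothStep a ε).continuousOn.mul
            (hG.mono hsub)).integrableOn_Icc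

/-- A continuous function on `[0,∞)` with nonnegative distributional derivative is monotone. -/
theorem monotoneOn_of_integral_deriv_mul_nonpos {G : ℝ → ℝ} (hG : ContinuousOn G (Set.Ici 0))
    (htest : ∀ φ : ℝ → ℝ, ContDiff ℝ (⊤ : ℕ∞) φ → HasCompactSupport φ →
      tsupport φ ⊆ Set.Ioi 0 → (∀ x, 0 ≤ φ x) → ∫ x, deriv φ x * G x ∂halfLine ≤ 0) :
    MonotoneOn G (Set.Ici 0) := by
  have hpos : ∀ x y : ℝ, 0 < x → x < y → G x ≤ G y := by
    intro x y hx hxy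
    by_contra! hlt
    obtain ⟨c₂, hc1, hc2⟩ := exists_between hlt
    obtain ⟨c₁, hc0, hc1⟩ := exists_between hc1
    have hy : 0 < y := hx.trans hxy
    have ev1 : ∀ᶠ s in 𝓝 x, c₂ < G s :=
      (hG.continuousAt (Ici_mem_nhds hx)).eventually_const_lt hc2
    have ev2 : ∀ᶠ s in 𝓝 y, G s < c₁ :=
      (hG.continuousAt (Ici_mem_nhds hy)).eventually_lt_const hc0
    obtain ⟨e₁, he1, h1⟩ := Metric.eventually_nhds_iff.1 ev1
    obtain ⟨e₂, he2, h2⟩ := Metric.eventually_nhds_iff.1 ev2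
    obtain ⟨ε, hε, hεm⟩ := exists_between (lt_min he1 he2)
    have hle1 : ∀ s ∈ Set.Icc x (x + ε), c₂ ≤ G s := fun s hs => le_of_lt (h1 (by
      rw [Real.dist_eq, abs_of_nonneg (by linarith [hs.1])]
      linarith [hs.2, min_le_left e₁ e₂]))
    have hle2 : ∀ s ∈ Set.Icc y (y + ε), -c₁ ≤ -G s := fun s hs => neg_le_neg (le_of_lt (h2 (by
      rw [Real.dist_eq, abs_of_nonneg (by linarith [hs.1])]
      linarith [hs.2, min_le_right e₁ e₂])))
    have hsupp : Function.support (fun s => smoothStep x ε s - smoothStep y ε s)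
        ⊆ Set.Icc x (y + ε) := by
      intro s hs
      by_contra hcon
      rw [Set.mem_Icc, not_and_or, not_le, not_le] at hcon
      apply hs
      rcases hcon with h | h
      · simp only
        rw [smoothStep_of_le hε h.le, smoothStep_of_le hε (by linarith), sub_zero]
      · simp only
        rw [smoothStep_of_ge hε (by linarith), smoothStep_of_ge hε h.le, sub_self]
    have hts := closure_minimal hsupp isClosed_Icc
    -- This bump is nonnegative because x < y; its derivative compares the average of G just after x
    -- with that just after y.
    have h3 := htest (fun s => smoothStep x ε s - smoothStep y ε s)
      ((contDiff_smoothStep x ε).sub (contDiff_smoothStep y ε))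
      (HasCompactSupport.of_support_subset_isCompact isCompact_Icc hsupp)
      (fun s hs => hx.trans_le (hts hs).1)
      (fun s => sub_nonneg.2 (Real.smoothTransition.monotone (by gcongr)))
    have h4 : ∀ s, deriv (fun s => smoothStep x ε s - smoothStep y ε s) s * G s
        = deriv (smoothStep x ε) s * G s + deriv (smoothStep y ε) s * (-G) s := fun s => by
      rw [deriv_fun_sub (differentiable_smoothStep x ε s) (differentiable_smoothStep y ε s),
        Pi.neg_apply]
      ring
    simp_rw [h4] at h3
    rw [integral_add (integrable_deriv_smoothStep_mul hx.le hε hG)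
      (integrable_deriv_smoothStep_mul hy.le hε hG.neg)] at h3
    have h5 := le_integral_deriv_smoothStep_mul hx.le hε hG hle1
    have h6 := le_integral_deriv_smoothStep_mul (G := -G) hy.le hε hG.neg hle2
    linarith
  intro x hx y hy hxy
  rcases eq_or_lt_of_le hxy with rfl | hxy
  · rfl
  -- Test functions do not see the endpoint 0, which is reached by continuity.
  rcases eq_or_lt_of_le (show (0 : ℝ) ≤ x from hx) with rfl | hx0
  · have h1 : Tendsto G (𝓝[>] 0) (𝓝 (G 0)) :=
      (hG 0 hx).mono_left (nhdsWithin_mono _ Set.Ioi_subset_Ici_self)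
    refine le_of_tendsto h1 ?_
    filter_upwards [Ioo_mem_nhdsGT hxy] with s hs using hpos s y hs.1 hs.2
  · exact hpos x y hx0 hxy

theorem integrable_ofReal_mul {φ : ℝ → ℝ} (hφ : Continuous φ) (hφc : HasCompactSupport φ)
    (u : L2Half) : Integrable (fun x => (φ x : ℂ) * u x) halfLine := by
  have h1 : LocallyIntegrable u halfLine := (Lp.memLp u).locallyIntegrable (by norm_num)
  refine (h1.integrable_smul_left_of_hasCompactSupport hφ hφc).congr
    (Eventually.of_forall fun x => ?_)
  simp

/-- Integrating factor: (e^{σx}u)' = e^{σx}(u' + σu), obtained by testing with φ(x)e^{σx}. The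
factor θ allows real and imaginary parts to be treated alike. -/
theorem HasWeakDeriv.monotoneOn {u v : L2Half} (huv : HasWeakDeriv u v) {g : ℝ → ℂ}
    (hg : ContinuousOn g (Set.Ici 0)) (hug : u =ᵐ[halfLine] g) (θ : ℂ) (σ : ℝ)
    (hpos : ∀ᵐ x ∂halfLine, 0 ≤ (θ * (v x + σ * u x)).re) :
    MonotoneOn (fun x => Real.exp (σ * x) * (θ * g x).re) (Set.Ici 0) := by
  refine monotoneOn_of_integral_deriv_mul_nonpos ?_ fun φ hφ hφc hφs hφ0 => ?_
  · exact (by fun_prop : Continuous fun x : ℝ => Real.exp (σ * x)).continuousOn.mul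
      (Complex.continuous_re.comp_continuousOn (continuousOn_const.mul hg))
  set e : ℝ → ℝ := fun x => Real.exp (σ * x) with he
  have hec : ContDiff ℝ (⊤ : ℕ∞) e := by fun_prop
  have hed : ∀ x, HasDerivAt e (e x * σ) x := fun x => by
    simpa using ((hasDerivAt_id x).const_mul σ).exp
  have hφd : ∀ x, HasDerivAt φ (deriv φ x) x := fun x =>
    ((hφ.differentiable (by simp)) x).hasDerivAt
  have hφ'c : HasCompactSupport (deriv φ) := hφc.deriv
  have hφ'cont : Continuous (deriv φ) := hφ.continuous_deriv (by simp)
  have hψd : ∀ x, deriv (fun x => φ x * e x) x = deriv φ x * e x + φ x * (e x * σ) :=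
    fun x => ((hφd x).mul (hed x)).deriv
  have hψ := huv (fun x => φ x * e x) (hφ.mul hec) hφc.mul_right
    ((tsupport_mul_subset_left).trans hφs)
  have i1 : Integrable (fun x => ((deriv φ x * e x : ℝ) : ℂ) * u x) halfLine :=
    integrable_ofReal_mul (hφ'cont.mul hec.continuous) hφ'c.mul_right u
  have i2 : Integrable (fun x => ((φ x * e x : ℝ) : ℂ) * u x) halfLine :=
    integrable_ofReal_mul (hφ.continuous.mul hec.continuous) hφc.mul_right u
  have i3 : Integrable (fun x => ((φ x * e x : ℝ) : ℂ) * v x) halfLine :=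
    integrable_ofReal_mul (hφ.continuous.mul hec.continuous) hφc.mul_right v
  have i4 : Integrable (fun x => ((φ x * e x : ℝ) : ℂ) * (v x + σ * u x)) halfLine := by
    refine (i3.add (i2.const_mul (σ : ℂ))).congr (Eventually.of_forall fun x => ?_)
    simp only [Pi.add_apply]
    ring
  have h1 : ∫ x, ((deriv φ x * e x : ℝ) : ℂ) * u x ∂halfLine
      = - ∫ x, ((φ x * e x : ℝ) : ℂ) * (v x + σ * u x) ∂halfLine := by
    have h2 : ∫ x, ((φ x * e x : ℝ) : ℂ) * (v x + σ * u x) ∂halfLine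
        = ∫ x, ((φ x * e x : ℝ) : ℂ) * v x ∂halfLine
          + σ * ∫ x, ((φ x * e x : ℝ) : ℂ) * u x ∂halfLine := by
      rw [← integral_const_mul, ← integral_add i3 (i2.const_mul _)]
      congr 1 with x
      ring
    have h3 : ∫ x, ((deriv (fun x => φ x * e x) x : ℝ) : ℂ) * u x ∂halfLine
        = ∫ x, ((deriv φ x * e x : ℝ) : ℂ) * u x ∂halfLine
          + σ * ∫ x, ((φ x * e x : ℝ) : ℂ) * u x ∂halfLine := by
      rw [← integral_const_mul, ← integral_add i1 (i2.const_mul _)]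
      congr 1 with x
      rw [hψd]
      push_cast
      ring
    rw [h3] at hψ
    rw [h2]
    linear_combination hψ
  have h4 : ∫ x, deriv φ x * (e x * (θ * g x).re) ∂halfLine
      = (θ * ∫ x, ((deriv φ x * e x : ℝ) : ℂ) * u x ∂halfLine).re := by
    rw [← integral_const_mul, ← RCLike.re_eq_complex_re, ← integral_re (i1.const_mul θ)]
    refine integral_congr_ae ?_
    filter_upwards [hug] with x hx
    rw [RCLike.re_eq_complex_re, mul_left_comm θ, Complex.re_ofReal_mul, hx]
    ring
  have h5 : (θ * ∫ x, ((φ x * e x : ℝ) : ℂ) * (v x + σ * u x) ∂halfLine).re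
      = ∫ x, (φ x * e x) * (θ * (v x + σ * u x)).re ∂halfLine := by
    rw [← integral_const_mul, ← RCLike.re_eq_complex_re, ← integral_re (i4.const_mul θ)]
    congr 1 with x
    rw [RCLike.re_eq_complex_re, mul_left_comm, Complex.re_ofReal_mul]
  rw [h4, h1, mul_neg, Complex.neg_re, h5, neg_nonpos]
  refine integral_nonneg_of_ae ?_
  filter_upwards [hpos] with x hx
  exact mul_nonneg (mul_nonneg (hφ0 x) (Real.exp_pos _).le) hx

theorem HasWeakDeriv.re_nonneg {u v : L2Half} (huv : HasWeakDeriv u v) {g : ℝ → ℂ}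
    (hg : ContinuousOn g (Set.Ici 0)) (hug : u =ᵐ[halfLine] g) (θ : ℂ) (σ : ℝ)
    (hpos : ∀ᵐ x ∂halfLine, 0 ≤ (θ * (v x + σ * u x)).re) (h0 : 0 ≤ (θ * g 0).re)
    {x : ℝ} (hx : 0 ≤ x) : 0 ≤ (θ * g x).re := by
  have h1 := huv.monotoneOn hg hug θ σ hpos (Set.mem_Ici.2 le_rfl) (Set.mem_Ici.2 hx) hx
  simp only [mul_zero, Real.exp_zero, one_mul] at h1
  exact nonneg_of_mul_nonneg_right (h0.trans h1) (Real.exp_pos _)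

/-- Square integrability replaces a boundary value: if the real part were positive at x,
monotonicity would keep |g| above a positive constant on [x, ∞). -/
theorem HasWeakDeriv.re_nonpos {u v : L2Half} (huv : HasWeakDeriv u v) {g : ℝ → ℂ}
    (hg : ContinuousOn g (Set.Ici 0)) (hug : u =ᵐ[halfLine] g) (θ : ℂ) {κ : ℝ} (hκ : 0 ≤ κ)
    (hpos : ∀ᵐ x ∂halfLine, 0 ≤ (θ * (v x + (-κ : ℝ) * u x)).re)
    {x : ℝ} (hx : 0 ≤ x) : (θ * g x).re ≤ 0 := by
  by_contra! hlt
  have hmono := huv.monotoneOn hg hug θ (-κ) hpos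
  set δ := Real.exp (-κ * x) * (θ * g x).re with hδ
  have hδ0 : 0 < δ := mul_pos (Real.exp_pos _) hlt
  have hθ : 0 < ‖θ‖ := norm_pos_iff.2 (by rintro rfl; simp at hlt)
  have hlow : ∀ y, x ≤ y → δ / ‖θ‖ ≤ ‖g y‖ := by
    intro y hxy
    have hy : 0 ≤ y := hx.trans hxy
    rw [div_le_iff₀ hθ, mul_comm, ← norm_mul]
    refine (hmono (Set.mem_Ici.2 hx) (Set.mem_Ici.2 hy) hxy).trans ?_
    calc Real.exp (-κ * y) * (θ * g y).re ≤ Real.exp (-κ * y) * ‖θ * g y‖ :=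
          mul_le_mul_of_nonneg_left (Complex.re_le_norm _) (Real.exp_pos _).le
      _ ≤ 1 * ‖θ * g y‖ := mul_le_mul_of_nonneg_right
          (Real.exp_le_one_iff.2 (by nlinarith)) (norm_nonneg _)
      _ = _ := one_mul _
  have hfin := (Lp.memLp u).meas_ge_lt_top (by norm_num) (by norm_num)
    (ε := (δ / ‖θ‖).toNNReal) (by simpa using div_pos hδ0 hθ)
  have hle : halfLine (Set.Ici x) ≤ halfLine {y | (δ / ‖θ‖).toNNReal ≤ ‖u y‖₊} := by
    refine measure_mono_ae ?_
    filter_upwards [hug] with y hy hxy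
    change (δ / ‖θ‖).toNNReal ≤ ‖u y‖₊
    rw [hy, Real.toNNReal_le_iff_le_coe]
    exact hlow y hxy
  rw [Measure.restrict_apply measurableSet_Ici, Set.Ici_inter_Ici, sup_of_le_left hx,
    Real.volume_Ici] at hle
  exact absurd hfin (not_lt.2 hle)

end PointInteraction

end

noncomputable section

namespace PointInteraction

/-! ### Linearity of weak derivatives and boundary values -/

theorem HasWeakDeriv.add {u v u' v' : L2Half} (hu : HasWeakDeriv u u') (hv : HasWeakDeriv v v') :
    HasWeakDeriv (u + v) (u' + v') := by
  intro φ hφ hφc hφs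
  have key : ∀ {ψ : ℝ → ℝ}, Continuous ψ → HasCompactSupport ψ → ∀ f g : L2Half,
      ∫ x, (ψ x : ℂ) * (f + g : L2Half) x ∂halfLine
        = ∫ x, (ψ x : ℂ) * f x ∂halfLine + ∫ x, (ψ x : ℂ) * g x ∂halfLine := by
    intro ψ hψ hψc f g
    rw [← integral_add (integrable_ofReal_mul hψ hψc f) (integrable_ofReal_mul hψ hψc g)]
    refine integral_congr_ae ?_
    filter_upwards [Lp.coeFn_add f g] with x hx
    rw [hx, Pi.add_apply, mul_add]
  rw [key (hφ.continuous_deriv (by simp)) hφc.deriv, key hφ.continuous hφc,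
    hu φ hφ hφc hφs, hv φ hφ hφc hφs, neg_add]

theorem HasWeakDeriv.smul {u u' : L2Half} (hu : HasWeakDeriv u u') (c : ℂ) :
    HasWeakDeriv (c • u) (c • u') := by
  intro φ hφ hφc hφs
  have key : ∀ (ψ : ℝ → ℝ) (f : L2Half),
      ∫ x, (ψ x : ℂ) * (c • f : L2Half) x ∂halfLine = c * ∫ x, (ψ x : ℂ) * f x ∂halfLine := by
    intro ψ f
    rw [← integral_const_mul]
    refine integral_congr_ae ?_
    filter_upwards [Lp.coeFn_smul c f] with x hx
    rw [hx, Pi.smul_apply, smul_eq_mul]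
    ring
  rw [key, key, hu φ hφ hφc hφs, mul_neg]

theorem HasBoundaryValue.add {u v : L2Half} {a b : ℂ} (hu : HasBoundaryValue u a)
    (hv : HasBoundaryValue v b) : HasBoundaryValue (u + v) (a + b) := by
  obtain ⟨g, hg, hug, rfl⟩ := hu
  obtain ⟨k, hk, hvk, rfl⟩ := hv
  refine ⟨fun x => g x + k x, hg.add hk, ?_, rfl⟩
  filter_upwards [Lp.coeFn_add u v, hug, hvk] with x h1 h2 h3
  rw [h1, Pi.add_apply, h2, h3]

theorem HasBoundaryValue.smul {u : L2Half} {a : ℂ} (hu : HasBoundaryValue u a) (c : ℂ) :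
    HasBoundaryValue (c • u) (c * a) := by
  obtain ⟨g, hg, hug, rfl⟩ := hu
  refine ⟨fun x => c * g x, continuousOn_const.mul hg, ?_, rfl⟩
  filter_upwards [Lp.coeFn_smul c u, hug] with x h1 h2
  rw [h1, Pi.smul_apply, h2, smul_eq_mul]

theorem HasWeakDeriv.unique {u v w : L2Half} (hv : HasWeakDeriv u v) (hw : HasWeakDeriv u w) :
    v = w := by
  have h1 := isOpen_Ioi.ae_eq_zero_of_integral_contDiff_smul_eq_zero (μ := halfLine)
    (U := Set.Ioi (0 : ℝ)) (f := fun x => (v - w : L2Half) x)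
    (((Lp.memLp (v - w)).locallyIntegrable (by norm_num)).locallyIntegrableOn _) ?_
  · refine Lp.ext ?_
    have h2 : ∀ᵐ x ∂halfLine, x ∈ Set.Ioi (0 : ℝ) := by
      rw [halfLine, ← restrict_Ioi_eq_restrict_Ici]
      exact ae_restrict_mem measurableSet_Ioi
    filter_upwards [h1, h2, Lp.coeFn_sub v w] with x hx1 hx2 hx3
    have := hx1 hx2
    rw [hx3, Pi.sub_apply] at this
    exact sub_eq_zero.1 this
  · intro φ hφ hφc hφs
    have h3 := (hv φ hφ hφc hφs).symm.trans (hw φ hφ hφc hφs)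
    have h4 : ∫ x, φ x • (v - w : L2Half) x ∂halfLine
        = ∫ x, (φ x : ℂ) * v x ∂halfLine - ∫ x, (φ x : ℂ) * w x ∂halfLine := by
      rw [← integral_sub (integrable_ofReal_mul hφ.continuous hφc v)
        (integrable_ofReal_mul hφ.continuous hφc w)]
      refine integral_congr_ae ?_
      filter_upwards [Lp.coeFn_sub v w] with x hx
      rw [hx, Pi.sub_apply, Complex.real_smul, mul_sub]
    rw [h4, neg_inj.1 h3, sub_self]

theorem HasBoundaryValue.unique {u : L2Half} {a b : ℂ} (ha : HasBoundaryValue u a)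
    (hb : HasBoundaryValue u b) : a = b := by
  obtain ⟨g, hg, hug, rfl⟩ := ha
  obtain ⟨k, hk, huk, rfl⟩ := hb
  refine Measure.eqOn_of_ae_eq (hug.symm.trans huk) hg hk ?_ (Set.mem_Ici.2 le_rfl)
  rw [interior_Ici, closure_Ioi]

/-! ### The boundary condition in terms of the Cayley transform -/

theorem cayleyDefined_I_mul_iff {A B : Matrix (Fin 2) (Fin 2) ℂ} {κ : ℝ} :
    CayleyDefined (Complex.I * κ) A B ↔ IsUnit (A - (κ : ℂ) • B) := by
  have h1 : Complex.I * (Complex.I * (κ : ℂ)) = -κ := by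
    rw [← mul_assoc, Complex.I_mul_I, neg_one_mul]
  rw [CayleyDefined, h1, neg_smul, sub_eq_add_neg]

/-- With N = A - κB one has N(I + 𝔖) = -2κB. Applying the injective N to the right-hand equation
turns it into -2κ(Aa + Bb) = 0. -/
theorem boundary_condition_iff {A B : Matrix (Fin 2) (Fin 2) ℂ} {κ : ℝ} (hκ : 0 < κ)
    (hdef : CayleyDefined (Complex.I * κ) A B) (a b : Fin 2 → ℂ) :
    A.mulVec a + B.mulVec b = 0 ↔
      (1 + cayley (Complex.I * κ) A B).mulVec ((κ : ℂ) • a + b) = (2 * κ : ℂ) • a := by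
  have hN := cayleyDefined_I_mul_iff.1 hdef
  set N := A - (κ : ℂ) • B with hNdef
  have hκ0 : (κ : ℂ) ≠ 0 := by exact_mod_cast hκ.ne'
  have h1 : Complex.I * (Complex.I * (κ : ℂ)) = -κ := by
    rw [← mul_assoc, Complex.I_mul_I, neg_one_mul]
  have hS : N * (1 + cayley (Complex.I * κ) A B) = -(2 * κ : ℂ) • B := by
    rw [cayley, h1, neg_smul, show A + -((κ : ℂ) • B) = N by rw [hNdef, sub_eq_add_neg], mul_add,
      mul_one, mul_neg, ← mul_assoc, Matrix.mul_nonsing_inv _ ((Matrix.isUnit_iff_isUnit_det N).1 hN), one_mul, hNdef]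
    module
  have hinj : Function.Injective N.mulVec := Matrix.mulVec_injective_of_isUnit hN
  rw [← hinj.eq_iff (a := Matrix.mulVec (1 + _) _), Matrix.mulVec_mulVec, hS]
  have h2 : (-(2 * κ : ℂ) • B).mulVec ((κ : ℂ) • a + b) - N.mulVec ((2 * κ : ℂ) • a)
      = -(2 * κ : ℂ) • (A.mulVec a + B.mulVec b) := by
    rw [hNdef]
    simp only [Matrix.mulVec_add, Matrix.smul_mulVec, Matrix.mulVec_smul, Matrix.sub_mulVec]
    module
  rw [← sub_eq_zero (b := N.mulVec _), h2, smul_eq_zero]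
  simp [hκ0]

theorem exists_cayleyDefined {A B : Matrix (Fin 2) (Fin 2) ℂ} (hreg : IsRegular A B) :
    ∃ κ : ℝ, 0 < κ ∧ CayleyDefined (Complex.I * κ) A B := by
  obtain ⟨-, k, hk⟩ := hreg
  by_contra! hcon
  have h1 := hcon 1 one_pos
  have h2 := hcon 2 two_pos
  have h3 := hcon 3 three_pos
  rw [cayleyDefined_I_mul_iff, Matrix.isUnit_iff_isUnit_det, isUnit_iff_ne_zero, not_not,
    Matrix.det_fin_two] at h1 h2 h3
  rw [Matrix.isUnit_iff_isUnit_det, isUnit_iff_ne_zero] at hk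
  apply hk
  rw [Matrix.det_fin_two]
  simp only [Matrix.sub_apply, Matrix.add_apply, Matrix.smul_apply, smul_eq_mul,
    Complex.ofReal_one, Complex.ofReal_ofNat] at h1 h2 h3 ⊢
  set z := Complex.I * k
  -- det(A + zB) has degree at most 2 in z; this is Lagrange interpolation at the nodes -1, -2, -3.
  linear_combination ((z + 2) * (z + 3) / 2) * h1 - (z + 1) * (z + 3) * h2
    + ((z + 1) * (z + 2) / 2) * h3

/-! ### Positivity of the resolvent -/

/-- The ray [0, ∞) is an intersection of three half-planes, so being real and nonnegative reduces to
inequalities between real parts. -/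
theorem re_im_of_rotations {z : ℂ} (h1 : 0 ≤ ((1 : ℂ) * z).re) (h2 : 0 ≤ (Complex.I * z).re)
    (h3 : 0 ≤ (-Complex.I * z).re) : z.im = 0 ∧ 0 ≤ z.re := by
  simp at h1 h2 h3
  exact ⟨le_antisymm h2 h3, h1⟩

theorem isPosFun_of_mem_laplacianGraph {A B : Matrix (Fin 2) (Fin 2) ℂ} {κ : ℝ} (hκ : 0 < κ)
    (hdef : CayleyDefined (Complex.I * κ) A B)
    (hS : LeavesQuadrantInvariant (1 + cayley (Complex.I * κ) A B)) {f u : L2Star}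
    (hf : IsPosFun f) (hu : (u, ((κ ^ 2 : ℝ) : ℂ) • (u - f)) ∈ laplacianGraph A B) :
    IsPosFun u := by
  obtain ⟨d, hud, hdw, a, b, ha, hb, hab⟩ := hu
  simp only at hud hdw ha
  choose g hg hug hga using ha
  choose k hk hdk hkb using hb
  -- First factor of the equation: v = u' + κu, for which v' - κv = -κ²f.
  have hv : ∀ j, HasWeakDeriv (d j + (κ : ℂ) • u j)
      (((κ ^ 2 : ℝ) : ℂ) • (u j - f j) + (κ : ℂ) • d j) := fun j =>
    (hdw j).add ((hud j).smul _)
  have hvc : ∀ j, ContinuousOn (fun x => k j x + κ * g j x) (Set.Ici 0) := fun j =>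
    (hk j).add (continuousOn_const.mul (hg j))
  have hvg : ∀ j, (d j + (κ : ℂ) • u j : L2Half) =ᵐ[halfLine] fun x => k j x + κ * g j x := by
    intro j
    filter_upwards [Lp.coeFn_add (d j) ((κ : ℂ) • u j), Lp.coeFn_smul (κ : ℂ) (u j), hug j,
      hdk j] with x h1 h2 h3 h4
    rw [h1, Pi.add_apply, h2, Pi.smul_apply, h3, h4, smul_eq_mul]
  have hv' : ∀ j, ∀ᵐ x ∂halfLine,
      (((κ ^ 2 : ℝ) : ℂ) • (u j - f j) + (κ : ℂ) • d j : L2Half) x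
        + ((-κ : ℝ) : ℂ) * (d j + (κ : ℂ) • u j : L2Half) x = -((κ ^ 2 : ℝ) : ℂ) * f j x := by
    intro j
    filter_upwards [Lp.coeFn_add (d j) ((κ : ℂ) • u j), Lp.coeFn_smul (κ : ℂ) (u j),
      Lp.coeFn_add (((κ ^ 2 : ℝ) : ℂ) • (u j - f j)) ((κ : ℂ) • d j),
      Lp.coeFn_smul (κ : ℂ) (d j), Lp.coeFn_smul ((κ ^ 2 : ℝ) : ℂ) (u j - f j),
      Lp.coeFn_sub (u j) (f j)] with x h1 h2 h3 h4 h5 h6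
    rw [h3, Pi.add_apply, h5, Pi.smul_apply, h6, h4, h1, Pi.add_apply, h2, Pi.smul_apply,
      Pi.smul_apply, Pi.sub_apply]
    simp only [smul_eq_mul]
    push_cast
    ring
  have hvpos : ∀ j x, 0 ≤ x →
      (k j x + κ * g j x).im = 0 ∧ 0 ≤ (k j x + κ * g j x).re := by
    intro j x hx
    have key : ∀ θ : ℂ, (∀ z : ℂ, z.im = 0 → 0 ≤ z.re → 0 ≤ (θ * z).re) →
        0 ≤ (θ * (k j x + κ * g j x)).re := by
      intro θ hθ
      have h1 := (hv j).re_nonpos (hvc j) (hvg j) (-θ) hκ.le ?_ hx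
      · rw [neg_mul, Complex.neg_re] at h1
        linarith
      · filter_upwards [hv' j, hf j] with y hy1 hy2
        rw [hy1]
        have e : -θ * (-((κ ^ 2 : ℝ) : ℂ) * f j y) = ((κ ^ 2 : ℝ) : ℂ) * (θ * f j y) := by ring
        rw [e, Complex.re_ofReal_mul]
        exact mul_nonneg (sq_nonneg κ) (hθ _ hy2.1 hy2.2)
    refine re_im_of_rotations (key 1 ?_) (key _ ?_) (key _ ?_)
    · intro z _ hz; simpa using hz
    · intro z hz _; simp [hz]
    · intro z hz _; simp [hz]
  -- The only use of the boundary condition: 2κu(0) = (I + 𝔖)v(0), where v(0) already lies in the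
  -- quadrant.
  have ha0 : ∀ j, (a j).im = 0 ∧ 0 ≤ (a j).re := by
    obtain ⟨η, hη, hηe⟩ := hS (fun j => (k j 0 + κ * g j 0).re) fun j => (hvpos j 0 le_rfl).2
    have h1 := (boundary_condition_iff hκ hdef a b).1 hab
    have h2 : (fun j => (((k j 0 + κ * g j 0).re : ℝ) : ℂ)) = (κ : ℂ) • a + b := by
      ext j
      rw [Pi.add_apply, Pi.smul_apply, ← hga, ← hkb, smul_eq_mul, add_comm (_ * _)]
      exact Complex.ext rfl (by simpa using (hvpos j 0 le_rfl).1.symm)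
    rw [h2, h1] at hηe
    intro j
    have h3 : ((2 * κ : ℝ) : ℂ) * a j = η j := by
      have := congrFun hηe j
      simpa using this
    have h4 := congrArg Complex.re h3
    have h5 := congrArg Complex.im h3
    rw [Complex.re_ofReal_mul, Complex.ofReal_re] at h4
    rw [Complex.im_ofReal_mul, Complex.ofReal_im] at h5
    have h6 : (0 : ℝ) < 2 * κ := by linarith
    exact ⟨(mul_eq_zero.1 h5).resolve_left h6.ne',
      nonneg_of_mul_nonneg_right (h4 ▸ hη j) h6⟩
  intro j
  have hw : ∀ᵐ x ∂halfLine, d j x + (κ : ℂ) * u j x = k j x + κ * g j x := by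
    filter_upwards [hug j, hdk j] with x h1 h2
    rw [h1, h2]
  have key : ∀ θ : ℂ, (∀ z : ℂ, z.im = 0 → 0 ≤ z.re → 0 ≤ (θ * z).re) → ∀ x, 0 ≤ x →
      0 ≤ (θ * g j x).re := by
    intro θ hθ x hx
    refine (hud j).re_nonneg (hg j) (hug j) θ κ ?_ ?_ hx
    · filter_upwards [hw, ae_restrict_mem measurableSet_Ici] with y hy1 hy2
      rw [hy1]
      exact hθ _ (hvpos j y hy2).1 (hvpos j y hy2).2
    · rw [hga j]
      exact hθ _ (ha0 j).1 (ha0 j).2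
  filter_upwards [hug j, ae_restrict_mem measurableSet_Ici] with x hx1 hx2
  rw [hx1]
  refine re_im_of_rotations (key 1 ?_ x hx2) (key _ ?_ x hx2) (key _ ?_ x hx2)
  · intro z _ hz; simpa using hz
  · intro z hz _; simp [hz]
  · intro z hz _; simp [hz]

end PointInteraction

end

noncomputable section

namespace PointInteraction

/-! ### Complex conjugation -/

/-- Complex conjugation on `L²([0,∞))`. -/
def conjL2 : L2Half →L[ℝ] L2Half :=
  (Complex.conjCLE : ℂ →L[ℝ] ℂ).compLpL 2 halfLine

theorem coeFn_conjL2 (f : L2Half) : conjL2 f =ᵐ[halfLine] fun x => starRingEnd ℂ (f x) :=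
  ContinuousLinearMap.coeFn_compLpL (Complex.conjCLE : ℂ →L[ℝ] ℂ) f

theorem conjL2_smul (c : ℂ) (f : L2Half) : conjL2 (c • f) = starRingEnd ℂ c • conjL2 f := by
  refine Lp.ext ?_
  filter_upwards [coeFn_conjL2 (c • f), Lp.coeFn_smul c f, coeFn_conjL2 f,
    Lp.coeFn_smul (starRingEnd ℂ c) (conjL2 f)] with x h1 h2 h3 h4
  rw [h1, h2, h4, Pi.smul_apply, Pi.smul_apply, h3, smul_eq_mul, smul_eq_mul, map_mul]

theorem conjL2_conjL2 (f : L2Half) : conjL2 (conjL2 f) = f := by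
  refine Lp.ext ?_
  filter_upwards [coeFn_conjL2 (conjL2 f), coeFn_conjL2 f] with x h1 h2
  rw [h1, h2, Complex.conj_conj]

theorem conjL2_eq_self_iff (f : L2Half) : conjL2 f = f ↔ ∀ᵐ x ∂halfLine, (f x).im = 0 := by
  constructor
  · intro h
    filter_upwards [coeFn_conjL2 f] with x hx
    rw [h] at hx
    exact Complex.conj_eq_iff_im.1 hx.symm
  · intro h
    refine Lp.ext ?_
    filter_upwards [coeFn_conjL2 f, h] with x h1 h2
    rw [h1, Complex.conj_eq_iff_im.2 h2]

/-- Componentwise complex conjugation on `L²([0,∞)) ⊕ L²([0,∞))`. -/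
def conjStar (f : L2Star) : L2Star := WithLp.toLp 2 fun j => conjL2 (f j)

theorem conjStar_apply (f : L2Star) (j : Fin 2) : conjStar f j = conjL2 (f j) := rfl

theorem continuous_conjStar : Continuous conjStar :=
  (PiLp.continuous_toLp 2 _).comp (continuous_pi fun j =>
    conjL2.continuous.comp (PiLp.continuous_apply 2 _ j))

theorem conjStar_add (f g : L2Star) : conjStar (f + g) = conjStar f + conjStar g := by
  ext1 j
  simp [conjStar_apply]

theorem conjStar_sub (f g : L2Star) : conjStar (f - g) = conjStar f - conjStar g := by
  ext1 j
  simp [conjStar_apply]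

theorem conjStar_smul (c : ℂ) (f : L2Star) :
    conjStar (c • f) = starRingEnd ℂ c • conjStar f := by
  ext1 j
  simp [conjStar_apply, conjL2_smul]

theorem conjStar_conjStar (f : L2Star) : conjStar (conjStar f) = f := by
  ext1 j
  simp only [conjStar_apply, conjL2_conjL2]

theorem isRealFun_iff (f : L2Star) : IsRealFun f ↔ conjStar f = f := by
  constructor
  · intro h
    ext1 j
    exact (conjL2_eq_self_iff _).2 (h j)
  · intro h j
    rw [← conjL2_eq_self_iff, ← conjStar_apply, h]

theorem isClosed_isRealFun : IsClosed {f : L2Star | IsRealFun f} := by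
  simp_rw [isRealFun_iff]
  exact isClosed_eq continuous_conjStar continuous_id

theorem isClosed_isPosFun : IsClosed {f : L2Star | IsPosFun f} := by
  have h1 : {f : L2Star | IsPosFun f} = {f | IsRealFun f} ∩
      ⋂ j, {f : L2Star | 0 ≤ Complex.reCLM.compLpL 2 halfLine (f j)} := by
    ext f
    have h2 : ∀ j, (0 ≤ Complex.reCLM.compLpL 2 halfLine (f j)) ↔
        ∀ᵐ x ∂halfLine, 0 ≤ (f j x).re := by
      intro j
      rw [← Lp.coeFn_nonneg]
      refine eventually_congr ?_
      filter_upwards [Complex.reCLM.coeFn_compLpL (f j)] with x hx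
      rw [hx]
      rfl
    change IsPosFun f ↔ IsRealFun f ∧ f ∈ ⋂ j, _
    rw [Set.mem_iInter]
    change (∀ j, _) ↔ (∀ j, _) ∧ ∀ j, (0 ≤ Complex.reCLM.compLpL 2 halfLine (f j))
    simp_rw [h2, ← forall_and, ← eventually_and]
  rw [h1]
  refine isClosed_isRealFun.inter (isClosed_iInter fun j => ?_)
  exact isClosed_le continuous_const
    ((Complex.reCLM.compLpL 2 halfLine).continuous.comp (PiLp.continuous_apply 2 _ j))

theorem HasWeakDeriv.conj {u v : L2Half} (h : HasWeakDeriv u v) :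
    HasWeakDeriv (conjL2 u) (conjL2 v) := by
  intro φ hφ hφc hφs
  have key : ∀ (ψ : ℝ → ℝ) (f : L2Half), ∫ x, (ψ x : ℂ) * conjL2 f x ∂halfLine
      = starRingEnd ℂ (∫ x, (ψ x : ℂ) * f x ∂halfLine) := by
    intro ψ f
    rw [← integral_conj]
    refine integral_congr_ae ?_
    filter_upwards [coeFn_conjL2 f] with x hx
    rw [hx, map_mul, Complex.conj_ofReal]
  rw [key, key, h φ hφ hφc hφs, map_neg]

theorem HasBoundaryValue.conj {u : L2Half} {a : ℂ} (h : HasBoundaryValue u a) :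
    HasBoundaryValue (conjL2 u) (starRingEnd ℂ a) := by
  obtain ⟨g, hg, hug, rfl⟩ := h
  refine ⟨fun x => starRingEnd ℂ (g x), Complex.continuous_conj.comp_continuousOn hg, ?_, rfl⟩
  filter_upwards [coeFn_conjL2 u, hug] with x h1 h2
  rw [h1, h2]

/-- A set of pairs that is invariant under complex conjugation. -/
def ConjInvariant (G : Set (L2Star × L2Star)) : Prop :=
  ∀ x y, (x, y) ∈ G → (conjStar x, conjStar y) ∈ G

/-- By complex linearity it is enough to look at the real functions f + f̄ and i(f - f̄). -/
theorem conjStar_op {T : C0Semigroup L2Star} (hT : IsRealSemigroup T) (t : ℝ≥0) (f : L2Star) :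
    conjStar (T.op t f) = T.op t (conjStar f) := by
  have hreal : ∀ g, conjStar g = g → conjStar (T.op t g) = T.op t g := fun g hg =>
    (isRealFun_iff _).1 (hT t g ((isRealFun_iff g).2 hg))
  have h1 := hreal (f + conjStar f) (by rw [conjStar_add, conjStar_conjStar, add_comm])
  have h2 := hreal (Complex.I • (f - conjStar f)) (by
    rw [conjStar_smul, conjStar_sub, conjStar_conjStar, Complex.conj_I, neg_smul, ← smul_neg,
      neg_sub])
  rw [map_add, conjStar_add] at h1
  rw [map_smul, map_sub, conjStar_smul, conjStar_sub, Complex.conj_I, neg_smul, ← smul_neg,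
    neg_sub] at h2
  have h3 := smul_right_injective _ Complex.I_ne_zero h2
  set P := T.op t f
  set Q := T.op t (conjStar f)
  have h5 : (2 : ℂ) • conjStar P = (2 : ℂ) • Q := by
    rw [two_smul, two_smul]
    calc conjStar P + conjStar P
        = (conjStar P + conjStar Q) - (conjStar Q - conjStar P) := by abel
      _ = (P + Q) - (P - Q) := by rw [h1, h3]
      _ = Q + Q := by abel
  exact smul_right_injective _ (two_ne_zero (α := ℂ)) h5

theorem conjInvariant_generatorGraph {T : C0Semigroup L2Star} (hT : IsRealSemigroup T) :
    ConjInvariant T.generatorGraph := by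
  intro x y hxy
  refine ((continuous_conjStar.tendsto y).comp hxy).congr fun t => ?_
  simp only [Function.comp]
  rw [conjStar_smul, conjStar_sub, conjStar_op hT, ← Complex.ofReal_inv, Complex.conj_ofReal]

/-- For real f, conjugating the resolvent equation gives the same equation, so uniqueness makes its
solution real. -/
theorem isRealSemigroup_of_conjInvariant {T : C0Semigroup L2Star} {ω : ℝ} (hω : 0 ≤ ω)
    (hT : ∀ t : ℝ≥0, ‖T.op t‖ ≤ Real.exp (ω * t)) (hG : ConjInvariant T.generatorGraph) :
    IsRealSemigroup T := by
  intro t f hf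
  refine C0Semigroup.op_mem_of_scaledResolvent_mem hT hω isClosed_isRealFun ?_ t hf
  filter_upwards [C0Semigroup.eventually_mul_le_half ω, self_mem_nhdsWithin] with h hh h0 x hx
  have hx : conjStar x = x := (isRealFun_iff x).1 hx
  refine (isRealFun_iff _).2 ?_
  have h1 := hG _ _ (C0Semigroup.scaledResolvent_mem_generatorGraph hT hh h0 x)
  have h2 := C0Semigroup.scaledResolvent_sub_smul_of_mem_generatorGraph hT hω hh h0 h1
  have hne : ((h : ℝ) : ℂ) ≠ 0 := by exact_mod_cast (ne_of_gt h0 : h ≠ 0)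
  rw [conjStar_smul, conjStar_sub, hx, ← Complex.ofReal_inv, Complex.conj_ofReal,
    Complex.ofReal_inv, smul_smul, mul_inv_cancel₀ hne, one_smul, sub_sub_cancel] at h2
  exact h2.symm

/-! ### Functions with prescribed boundary values -/

theorem memLp_exp {c : ℝ} (hc : 0 < c) :
    MemLp (fun x : ℝ => ((Real.exp (-c * x) : ℝ) : ℂ)) 2 halfLine := by
  have hcont : Continuous fun x : ℝ => ((Real.exp (-c * x) : ℝ) : ℂ) := by fun_prop
  refine (memLp_two_iff_integrable_sq_norm hcont.aestronglyMeasurable).2 ?_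
  have h1 : IntegrableOn (fun x : ℝ => Real.exp (-(2 * c) * x)) (Set.Ici 0) :=
    (integrableOn_Ici_iff_integrableOn_Ioi (by simp)).2 (exp_neg_integrableOn_Ioi 0 (by linarith))
  refine h1.congr (Eventually.of_forall fun x => ?_)
  simp only
  rw [Complex.norm_real, Real.norm_of_nonneg (Real.exp_pos _).le, ← Real.exp_nat_mul]
  congr 1
  push_cast
  ring

/-- The function `x ↦ e^{-c x}` as an element of `L²([0,∞))`. -/
def expL2 (c : ℝ) (hc : 0 < c) : L2Half := (memLp_exp hc).toLp _

theorem coeFn_expL2 (c : ℝ) (hc : 0 < c) :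
    expL2 c hc =ᵐ[halfLine] fun x => ((Real.exp (-c * x) : ℝ) : ℂ) :=
  (memLp_exp hc).coeFn_toLp

theorem hasBoundaryValue_expL2 (c : ℝ) (hc : 0 < c) : HasBoundaryValue (expL2 c hc) 1 :=
  ⟨fun x => ((Real.exp (-c * x) : ℝ) : ℂ),
    (by fun_prop : Continuous fun x : ℝ => ((Real.exp (-c * x) : ℝ) : ℂ)).continuousOn,
    coeFn_expL2 c hc, by simp⟩

theorem hasWeakDeriv_expL2 (c : ℝ) (hc : 0 < c) :
    HasWeakDeriv (expL2 c hc) ((-c : ℂ) • expL2 c hc) := by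
  intro φ hφ hφc hφs
  set e : ℝ → ℝ := fun x => Real.exp (-c * x) with he
  have hec : Continuous e := by fun_prop
  have hed : ∀ x, HasDerivAt e (e x * -c) x := fun x => by
    simpa [he] using ((hasDerivAt_id x).const_mul (-c)).exp
  have hφd : ∀ x, HasDerivAt φ (deriv φ x) x := fun x =>
    ((hφ.differentiable (by simp)) x).hasDerivAt
  have hφ' : Continuous (deriv φ) := hφ.continuous_deriv (by simp)
  have hout : ∀ x, x ∉ Set.Ici (0 : ℝ) → φ x = 0 ∧ deriv φ x = 0 := by
    intro x hx
    have hx' : x ∉ tsupport φ := fun h => hx (Set.Ioi_subset_Ici_self (hφs h))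
    exact ⟨image_eq_zero_of_notMem_tsupport hx',
      image_eq_zero_of_notMem_tsupport fun h => hx' (tsupport_deriv_subset h)⟩
  have key : ∀ f : ℝ → ℝ, (∀ x, x ∉ Set.Ici (0 : ℝ) → f x = 0) →
      ∫ x, (f x : ℂ) ∂halfLine = ((∫ x, f x : ℝ) : ℂ) := fun f hf => by
    rw [integral_complex_ofReal, setIntegral_eq_integral_of_forall_compl_eq_zero hf]
  have h1 : ∫ x, ((deriv φ x : ℝ) : ℂ) * expL2 c hc x ∂halfLine
      = ((∫ x, deriv φ x * e x : ℝ) : ℂ) := by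
    rw [← key _ (fun x hx => by rw [(hout x hx).2, zero_mul])]
    refine integral_congr_ae ?_
    filter_upwards [coeFn_expL2 c hc] with x hx
    rw [hx, Complex.ofReal_mul]
  have h2 : ∫ x, (φ x : ℂ) * ((-c : ℂ) • expL2 c hc : L2Half) x ∂halfLine
      = ((∫ x, φ x * (e x * -c) : ℝ) : ℂ) := by
    rw [← key _ (fun x hx => by rw [(hout x hx).1, zero_mul])]
    refine integral_congr_ae ?_
    filter_upwards [coeFn_expL2 c hc, Lp.coeFn_smul (-c : ℂ) (expL2 c hc)] with x hx hx'
    rw [hx', Pi.smul_apply, hx, smul_eq_mul, Complex.ofReal_mul, Complex.ofReal_mul,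
      Complex.ofReal_neg]
    ring
  have h3 : ∫ x, φ x * (e x * -c) = - ∫ x, deriv φ x * e x := by
    refine integral_mul_deriv_eq_deriv_mul_of_integrable (fun x _ => hφd x) (fun x _ => hed x)
      ?_ ?_ ?_
    · exact (hφ.continuous.mul (hec.mul continuous_const)).integrable_of_hasCompactSupport
        hφc.mul_right
    · exact (hφ'.mul hec).integrable_of_hasCompactSupport hφc.deriv.mul_right
    · exact (hφ.continuous.mul hec).integrable_of_hasCompactSupport hφc.mul_right
  rw [h1, h2, h3, Complex.ofReal_neg, neg_neg]

theorem exists_hasBoundaryValue (a b : ℂ) : ∃ u d w : L2Half, HasWeakDeriv u d ∧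
    HasWeakDeriv d w ∧ HasBoundaryValue u a ∧ HasBoundaryValue d b := by
  have d1 := hasWeakDeriv_expL2 1 one_pos
  have d2 := hasWeakDeriv_expL2 2 two_pos
  have b1 := hasBoundaryValue_expL2 1 one_pos
  have b2 := hasBoundaryValue_expL2 2 two_pos
  -- In αe^{-x} + βe^{-2x} the coefficients solve α + β = a and -α - 2β = b.
  refine ⟨_, _, _, (d1.smul (2 * a + b)).add (d2.smul (-(a + b))),
    ((d1.smul _).smul (2 * a + b)).add ((d2.smul _).smul (-(a + b))), ?_, ?_⟩
  · convert (b1.smul (2 * a + b)).add (b2.smul (-(a + b))) using 1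
    ring
  · convert ((b1.smul _).smul (2 * a + b)).add ((b2.smul _).smul (-(a + b))) using 1
    push_cast
    ring

/-! ### Conjugation invariance of the boundary conditions -/

/-- All pairs (a, b) occur as boundary data, and weak derivatives and boundary values are unique, so
only the boundary condition matters. -/
theorem conjInvariant_laplacianGraph_iff {A B : Matrix (Fin 2) (Fin 2) ℂ} :
    ConjInvariant (laplacianGraph A B) ↔ ∀ a b : Fin 2 → ℂ, A.mulVec a + B.mulVec b = 0 →
      A.mulVec (fun j => starRingEnd ℂ (a j)) + B.mulVec (fun j => starRingEnd ℂ (b j)) = 0 := by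
  constructor
  · intro h a b hab
    choose u d w hud hdw hua hdb using fun j => exists_hasBoundaryValue (a j) (b j)
    obtain ⟨d', hud', -, a', b', ha', hb', hab'⟩ := h (WithLp.toLp 2 u) (WithLp.toLp 2 w)
      ⟨WithLp.toLp 2 d, hud, hdw, a, b, hua, hdb, hab⟩
    have hd : ∀ j, d' j = conjL2 (d j) := fun j => (hud' j).unique (hud j).conj
    have ha : a' = fun j => starRingEnd ℂ (a j) :=
      funext fun j => (ha' j).unique (hua j).conj
    have hb : b' = fun j => starRingEnd ℂ (b j) :=
      funext fun j => (hb' j).unique (by rw [hd]; exact (hdb j).conj)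
    rw [← ha, ← hb]
    exact hab'
  · rintro h x y ⟨d, hxd, hdy, a, b, ha, hb, hab⟩
    exact ⟨conjStar d, fun j => (hxd j).conj, fun j => (hdy j).conj, _, _,
      fun j => (ha j).conj, fun j => (hb j).conj, h a b hab⟩

theorem hasRealEntries_iff {M : Matrix (Fin 2) (Fin 2) ℂ} :
    HasRealEntries M ↔ M.map (starRingEnd ℂ) = M := by
  rw [← Matrix.ext_iff]
  simp only [HasRealEntries, Matrix.map_apply, Complex.conj_eq_iff_im]

theorem hasRealEntries_cayley_iff {A B : Matrix (Fin 2) (Fin 2) ℂ} {κ : ℝ} (hκ : 0 < κ)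
    (hdef : CayleyDefined (Complex.I * κ) A B) :
    HasRealEntries (cayley (Complex.I * κ) A B) ↔ ConjInvariant (laplacianGraph A B) := by
  rw [conjInvariant_laplacianGraph_iff]
  simp only [boundary_condition_iff hκ hdef]
  set S := 1 + cayley (Complex.I * κ) A B with hS
  have hκ0 : (κ : ℂ) ≠ 0 := by exact_mod_cast hκ.ne'
  have h1 : HasRealEntries (cayley (Complex.I * κ) A B) ↔ S.map (starRingEnd ℂ) = S := by
    rw [hasRealEntries_iff, hS, Matrix.map_add _ (map_add _),
      Matrix.map_one _ (map_zero _) (map_one _), add_right_inj]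
  have hmap : ∀ v : Fin 2 → ℂ, (fun j => starRingEnd ℂ (S.mulVec v j))
      = (S.map (starRingEnd ℂ)).mulVec fun j => starRingEnd ℂ (v j) := fun v =>
    funext fun j => RingHom.map_mulVec (starRingEnd ℂ) S v j
  rw [h1]
  constructor
  · intro hreal a b hab
    have h2 := hmap ((κ : ℂ) • a + b)
    rw [hab, hreal] at h2
    have e1 : (fun j => starRingEnd ℂ (((κ : ℂ) • a + b) j))
        = (κ : ℂ) • (fun j => starRingEnd ℂ (a j)) + fun j => starRingEnd ℂ (b j) := by
      ext j; simp
    have e2 : (fun j => starRingEnd ℂ (((2 * κ : ℂ) • a) j))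
        = (2 * κ : ℂ) • fun j => starRingEnd ℂ (a j) := by
      ext j; simp [map_ofNat]
    rw [← e1, ← e2, h2]
  · intro hinv
    have key : ∀ v : Fin 2 → ℂ, (∀ j, starRingEnd ℂ (v j) = v j) →
        (S.map (starRingEnd ℂ)).mulVec v = S.mulVec v := by
      intro v hv
      -- The admissible data with κa + b = v; for real v the conjugate data have the same v, so
      -- conjugation fixes Sv.
      set a : Fin 2 → ℂ := (2 * κ : ℂ)⁻¹ • S.mulVec v with ha
      have hne : (2 * κ : ℂ) ≠ 0 := mul_ne_zero two_ne_zero hκ0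
      have h3 : (2 * κ : ℂ) • a = S.mulVec v := by
        rw [ha, smul_smul, mul_inv_cancel₀ hne, one_smul]
      have h4 := hinv a (v - (κ : ℂ) • a) (by rw [add_sub_cancel, h3])
      have e1 : (κ : ℂ) • (fun j => starRingEnd ℂ (a j))
          + (fun j => starRingEnd ℂ ((v - (κ : ℂ) • a) j)) = v := by
        ext j; simp [hv]
      have e2 : (2 * κ : ℂ) • (fun j => starRingEnd ℂ (a j))
          = fun j => starRingEnd ℂ (S.mulVec v j) := by
        ext j; rw [← h3]; simp [map_ofNat]
      rw [e1, e2, hmap] at h4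
      simp only [hv] at h4
      exact h4.symm
    refine Matrix.ext_of_mulVec_single fun i => key _ fun j => ?_
    by_cases hij : j = i
    · subst hij; simp
    · simp [hij]

/-! ### From boundary conditions to the semigroup -/

theorem isRealSemigroup_iff_conjInvariant {A B : Matrix (Fin 2) (Fin 2) ℂ}
    {T : C0Semigroup L2Star} (hgen : IsGeneratedByLaplacian T A B) {ω : ℝ} (hω : 0 ≤ ω)
    (hT : ∀ t : ℝ≥0, ‖T.op t‖ ≤ Real.exp (ω * t)) :
    IsRealSemigroup T ↔ ConjInvariant (laplacianGraph A B) := by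
  rw [← hgen]
  exact ⟨conjInvariant_generatorGraph, isRealSemigroup_of_conjInvariant hω hT⟩

theorem isPositiveSemigroup_of_leavesQuadrantInvariant {A B : Matrix (Fin 2) (Fin 2) ℂ}
    {T : C0Semigroup L2Star} (hgen : IsGeneratedByLaplacian T A B) {ω : ℝ} (hω : 0 ≤ ω)
    (hT : ∀ t : ℝ≥0, ‖T.op t‖ ≤ Real.exp (ω * t)) {κ₀ : ℝ}
    (hS : ∀ κ : ℝ, κ₀ ≤ κ → CayleyDefined (Complex.I * κ) A B ∧
      LeavesQuadrantInvariant (1 + cayley (Complex.I * κ) A B)) :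
    IsPositiveSemigroup T := by
  intro t f hf
  refine C0Semigroup.op_mem_of_scaledResolvent_mem hT hω isClosed_isPosFun ?_ t hf
  -- With κ = h^{-1/2}, small h corresponds to large κ, which is why the hypothesis for κ ≥ κ₀
  -- suffices.
  have hlarge : ∀ᶠ h : ℝ≥0 in 𝓝[>] 0, κ₀ ≤ Real.sqrt ((h : ℝ)⁻¹) := by
    have hc : Tendsto (fun h : ℝ≥0 => (h : ℝ)) (𝓝[>] 0) (𝓝[>] 0) := by
      refine tendsto_nhdsWithin_of_tendsto_nhds_of_eventually_within _
        (NNReal.continuous_coe.tendsto' 0 0 rfl |>.mono_left nhdsWithin_le_nhds) ?_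
      filter_upwards [self_mem_nhdsWithin] with t ht using NNReal.coe_pos.2 ht
    exact (Real.tendsto_sqrt_atTop.comp (tendsto_inv_nhdsGT_zero.comp hc)).eventually_ge_atTop κ₀
  filter_upwards [C0Semigroup.eventually_mul_le_half ω, hlarge, self_mem_nhdsWithin]
    with h hh hκ h0 x hx
  have h0' : (0 : ℝ) < (h : ℝ)⁻¹ := inv_pos.2 (NNReal.coe_pos.2 h0)
  obtain ⟨hdef, hinv⟩ := hS _ hκ
  refine isPosFun_of_mem_laplacianGraph (Real.sqrt_pos.2 h0') hdef hinv hx ?_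
  rw [Real.sq_sqrt h0'.le, Complex.ofReal_inv, ← hgen]
  exact C0Semigroup.scaledResolvent_mem_generatorGraph hT hh h0 x

end PointInteraction

end

open PointInteraction in
theorem corollary5p3 (A B : Matrix (Fin 2) (Fin 2) ℂ) (hreg : IsRegular A B)
    (T : C0Semigroup L2Star) (hgen : IsGeneratedByLaplacian T A B)
    (hqc : T.IsQuasiContractive) :
    (IsRealSemigroup T ↔
      ∀ κ : ℝ, 0 < κ → CayleyDefined (Complex.I * κ) A B →
        HasRealEntries (cayley (Complex.I * κ) A B)) ∧
    (IsRealSemigroup T ↔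
      ∃ κ : ℝ, 0 < κ ∧ CayleyDefined (Complex.I * κ) A B ∧
        HasRealEntries (cayley (Complex.I * κ) A B)) ∧
    ((∃ κ₀ : ℝ, ∀ κ : ℝ, κ₀ ≤ κ → CayleyDefined (Complex.I * κ) A B ∧
        LeavesQuadrantInvariant (1 + cayley (Complex.I * κ) A B)) →
      IsPositiveSemigroup T) := by
  obtain ⟨ω₀, hω₀⟩ := hqc
  -- Raising the growth bound to a nonnegative one only weakens it, and the resolvent estimates use
  -- ω ≥ 0.
  have hω : 0 ≤ max ω₀ 0 := le_max_right _ _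
  have hT : ∀ t : ℝ≥0, ‖T.op t‖ ≤ Real.exp (max ω₀ 0 * t) := fun t =>
    (hω₀ t).trans (Real.exp_le_exp.2 (mul_le_mul_of_nonneg_right (le_max_left _ _) t.2))
  have hreal := isRealSemigroup_iff_conjInvariant hgen hω hT
  obtain ⟨κ₁, hκ₁, hdef₁⟩ := exists_cayleyDefined hreg
  refine ⟨⟨fun h κ hκ hdef => ?_, fun h => ?_⟩, ⟨fun h => ?_, ?_⟩, ?_⟩
  · exact (hasRealEntries_cayley_iff hκ hdef).2 (hreal.1 h)
  · exact hreal.2 ((hasRealEntries_cayley_iff hκ₁ hdef₁).1 (h κ₁ hκ₁ hdef₁))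
  · exact ⟨κ₁, hκ₁, hdef₁, (hasRealEntries_cayley_iff hκ₁ hdef₁).2 (hreal.1 h)⟩
  · rintro ⟨κ, hκ, hdef, h⟩
    exact hreal.2 ((hasRealEntries_cayley_iff hκ hdef).1 h)
  · rintro ⟨κ₀, h⟩
    exact isPositiveSemigroup_of_leavesQuadrantInvariant hgen hω hT h
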